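/- Let $n,m\ge 0$ and let $A\in\mathbb R^{n\times n}$, $B\in\mathbb R^{n\times m}$, $Q\in\mathbb R^{n\times n}$, $S\in\mathbb R^{m\times n}$, $R\in\mathbb R^{m\times m}$, $P^{\mathrm f}\in\mathbb R^{n\times n}$. Put $$H=\begin{pmatrix}Q&S^\top\\ S&R\end{pmatrix},\qquad \ell(x,u)=\begin{pmatrix}x\\u\end{pmatrix}^{\!\top}H\begin{pmatrix}x\\u\end{pmatrix},$$ and consider the infinite-horizon problem $$V(x_0)=\min_{u_0,u_1,\dots}\ \lim_{N\to\infty}\Big(\sum_{k=0}^{N-1}\ell(x_k,u_k)+x_N^\top P^{\mathrm f}x_N\Big)\quad\text{s.t. } x_{k+1}=Ax_k+Bu_k, \tag{1}$$ with limits taken in $[-\infty,+\infty]$. A symmetric matrix $P$ solves the discrete algebraic Riccati equation (DARE) if $R+B^\top PB$ is invertible and $$P=Q+A^\top PA-(S^\top+A^\top PB)K,\qquad K=(R+B^\top PB)^{-1}(S+B^\top PA);$$ it is a stabilizing solution if moreover all eigenvalues $\mu\in\mathbb C$ of $A-BK$ satisfy $|\mu|<1$. The pair $(A,B)$ is stabilizable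 if there is a matrix $\hat K\in\mathbb R^{m\times n}$ such that all eigenvalues of $A-B\hat K$ have modulus less than $1$. Quadratic strict $(x,u)$-pre-dissipativity holds if there are $\Lambda\in\mathbb R^{n\times n}$ and $\epsilon>0$ such that, for all $x\in\mathbb R^n$ and $u\in\mathbb R^m$, $$\begin{pmatrix}x\\u\end{pmatrix}^{\!\top}\begin{pmatrix}Q+\Lambda-A^\top\Lambda A& S^\top-A^\top\Lambda B\\ S-B^\top\Lambda A& R-B^\top\Lambda B\end{pmatrix}\begin{pmatrix}x\\u\end{pmatrix}\ \ge\ \epsilon\,(\|x\|^2+\|u\|^2).$$ Theorem. Let $H$ be symmetric positive semidefinite, let $P^{\mathrm f}$ be symmetric positive definite, let $(A,B)$ be stabilizable, and let quadratic strict $(x,u)$-pre-dissipativity hold. Then the DARE has a stabilizing solution. The limit in (1) exists in $[-\infty,+\infty]$ for every $x_0$ and every input sequence. If $P$ is a stabilizing solution of the DARE, with associated $K$, then the value function and the optimal feedback of (1) are those given by $P$: for every $x_0\in\mathbb R^n$ the minimum in (1) is attained and $V(x_0)=x_0^\top Px_0$, and an input sequence $(u_k)$ is optimal for $x_0$ if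 and only if $u_k=-Kx_k$ for all $k\ge0$, where $(x_k)$ is the corresponding state trajectory. -/

import Mathlib

open Filter Topology Matrix

noncomputable section

/-- The data of a linear-quadratic problem with `n` states and `m` inputs: the system
`x⁺ = A x + B u`, the blocks of the stage cost matrix `H = [Q, Sᵀ; S, R]`, and the terminal
cost matrix `Pf`. -/
structure LQProblem (n m : ℕ) where
  A : Matrix (Fin n) (Fin n) ℝ
  B : Matrix (Fin n) (Fin m) ℝ
  Q : Matrix (Fin n) (Fin n) ℝ
  S : Matrix (Fin m) (Fin n) ℝ
  R : Matrix (Fin m) (Fin m) ℝ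
  Pf : Matrix (Fin n) (Fin n) ℝ

/-- A real square matrix is Schur stable if all its complex eigenvalues satisfy `|μ| < 1`. -/
def IsSchurStable {n : ℕ} (M : Matrix (Fin n) (Fin n) ℝ) : Prop :=
  ∀ μ : ℂ, Module.End.HasEigenvalue (Matrix.toLin' (M.map (algebraMap ℝ ℂ))) μ → ‖μ‖ < 1

/-- `(A, B)` is stabilizable: some linear state feedback `u = -K x` makes `A - B K` Schur stable. -/
def IsStabilizable {n m : ℕ} (A : Matrix (Fin n) (Fin n) ℝ) (B : Matrix (Fin n) (Fin m) ℝ) :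
    Prop :=
  ∃ K : Matrix (Fin m) (Fin n) ℝ, IsSchurStable (A - B * K)

namespace LQProblem

variable {n m : ℕ} (p : LQProblem n m)

/-- The stage cost matrix `H = [Q, Sᵀ; S, R]`. -/
def H : Matrix (Fin n ⊕ Fin m) (Fin n ⊕ Fin m) ℝ :=
  Matrix.fromBlocks p.Q p.Sᵀ p.S p.R

/-- The stage cost `ℓ(x, u) = [x; u]ᵀ H [x; u]`. -/
def stageCost (x : Fin n → ℝ) (u : Fin m → ℝ) : ℝ :=
  Sum.elim x u ⬝ᵥ (p.H *ᵥ Sum.elim x u)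

/-- The rotated stage cost matrix `H_Λ`, for the storage function `λ(x) = xᵀ Λ x`. -/
def rotatedH (L : Matrix (Fin n) (Fin n) ℝ) : Matrix (Fin n ⊕ Fin m) (Fin n ⊕ Fin m) ℝ :=
  Matrix.fromBlocks
    (p.Q + L - p.Aᵀ * L * p.A) (p.Sᵀ - p.Aᵀ * L * p.B)
    (p.S - p.Bᵀ * L * p.A) (p.R - p.Bᵀ * L * p.B)

/-- Quadratic strict `(x,u)`-pre-dissipativity: for some `Λ` and some `ε > 0`,
`[x; u]ᵀ H_Λ [x; u] ≥ ε (‖x‖² + ‖u‖²)` for all `x`, `u` (Euclidean norms). -/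
def QuadStrictPreDissipative : Prop :=
  ∃ L : Matrix (Fin n) (Fin n) ℝ, ∃ ε : ℝ, 0 < ε ∧
    ∀ (x : Fin n → ℝ) (u : Fin m → ℝ),
      ε * (x ⬝ᵥ x + u ⬝ᵥ u) ≤ Sum.elim x u ⬝ᵥ (p.rotatedH L *ᵥ Sum.elim x u)

/-- The state trajectory `x₀, x₁, …` with `x_{k+1} = A x_k + B u_k`. -/
def state (x₀ : Fin n → ℝ) (u : ℕ → Fin m → ℝ) : ℕ → Fin n → ℝ
  | 0 => x₀
  | k + 1 => p.A *ᵥ state x₀ u k + p.B *ᵥ u k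

/-- The cost over the horizon `N`: `∑_{k<N} ℓ(x_k, u_k) + x_Nᵀ Pf x_N`. -/
def finiteCost (x₀ : Fin n → ℝ) (u : ℕ → Fin m → ℝ) (N : ℕ) : ℝ :=
  (∑ k ∈ Finset.range N, p.stageCost (p.state x₀ u k) (u k)) +
    p.state x₀ u N ⬝ᵥ (p.Pf *ᵥ p.state x₀ u N)

/-- `J` is the infinite-horizon cost of the input sequence `u` from `x₀`: the finite-horizon
costs converge to `J` in `[-∞, +∞]` as `N → ∞`. -/
def HasInfiniteCost (x₀ : Fin n → ℝ) (u : ℕ → Fin m → ℝ) (J : EReal) : Prop :=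
  Tendsto (fun N => ((p.finiteCost x₀ u N : ℝ) : EReal)) atTop (𝓝 J)

/-- The set of costs over which the infinite-horizon problem minimizes. -/
def infiniteCosts (x₀ : Fin n → ℝ) : Set EReal :=
  {J | ∃ u : ℕ → Fin m → ℝ, p.HasInfiniteCost x₀ u J}

/-- `V` is the optimal value function of the infinite-horizon problem (the minimum is attained
for every initial state). -/
def IsValueFunction (V : (Fin n → ℝ) → ℝ) : Prop :=
  ∀ x₀, IsLeast (p.infiniteCosts x₀) (V x₀ : EReal)

/-- `u` is an optimal input sequence of the infinite-horizon problem from `x₀`. -/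
def IsOptimalInput (x₀ : Fin n → ℝ) (u : ℕ → Fin m → ℝ) : Prop :=
  ∃ J, p.HasInfiniteCost x₀ u J ∧ IsLeast (p.infiniteCosts x₀) J

/-- `F` is the optimal feedback law of the infinite-horizon problem: from every initial state the
optimal input sequences are exactly those generated by `u_k = F(x_k)` (there is precisely one
such sequence, namely the one obtained by closing the loop with `F`). -/
def IsOptimalFeedback (F : (Fin n → ℝ) → Fin m → ℝ) : Prop :=
  ∀ x₀ u, p.IsOptimalInput x₀ u ↔ ∀ k, u k = F (p.state x₀ u k)

/-- The gain `K = (R + Bᵀ P B)⁻¹ (S + Bᵀ P A)` associated with `P`. -/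
def gain (P : Matrix (Fin n) (Fin n) ℝ) : Matrix (Fin m) (Fin n) ℝ :=
  (p.R + p.Bᵀ * P * p.B)⁻¹ * (p.S + p.Bᵀ * P * p.A)

/-- `P` is a symmetric solution of the discrete algebraic Riccati equation
`P = Q + Aᵀ P A - (Sᵀ + Aᵀ P B) K`, where `K` is the gain of `P`; the inverse in `K` exists. -/
structure IsDARESolution (P : Matrix (Fin n) (Fin n) ℝ) : Prop where
  symm : P.IsSymm
  isUnit : IsUnit (p.R + p.Bᵀ * P * p.B)
  eqn : P = p.Q + p.Aᵀ * P * p.A - (p.Sᵀ + p.Aᵀ * P * p.B) * p.gain P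

/-- `P` is a stabilizing solution of the DARE: moreover `A - B K` is Schur stable. -/
structure IsStabilizingSolution (P : Matrix (Fin n) (Fin n) ℝ) : Prop where
  isSolution : p.IsDARESolution P
  schur : IsSchurStable (p.A - p.B * p.gain P)

end LQProblem

end

/-! Write `ℓ` for the stage cost; pre-dissipativity says that `ℓ(x,u) + L(x) - L(Ax+Bu)` dominates
`ε(‖x‖² + ‖u‖²)`. Existence (`exists_isStabilizingSolution`): value iteration of the Riccati map
started at `-L` increases, and the cost of a stabilizing feedback bounds it above. Its limit `X`
solves the DARE, and `X + L ≥ 0` is a Lyapunov function for the closed loop. Optimality: completing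
the square gives, for any DARE solution `P`, cost up to `N` plus `P(x_N)` equals `P(x₀)` plus
weighted squares of `u_k + K x_k`. To replace `P(x_N)` by the terminal cost, `x_N → 0` is needed.
`finiteCost_dichotomy` supplies it for every input whose cost does not diverge to `+∞`: escape with
`L(x_N) → -∞` is penalized by `Pf > 0`, and otherwise dissipation makes `∑ ‖x_k‖²` finite. -/

/-- The quadratic form `x ↦ xᵀ P x`. -/
def quad {n : ℕ} (P : Matrix (Fin n) (Fin n) ℝ) (x : Fin n → ℝ) : ℝ := x ⬝ᵥ (P *ᵥ x)

/-! ### Quadratic forms -/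

section quad

variable {n m : ℕ}

lemma dotProduct_transpose_mulVec (M : Matrix (Fin m) (Fin n) ℝ) (x : Fin n → ℝ)
    (u : Fin m → ℝ) : x ⬝ᵥ (Mᵀ *ᵥ u) = (M *ᵥ x) ⬝ᵥ u := by
  rw [Matrix.mulVec_transpose, dotProduct_comm, ← Matrix.dotProduct_mulVec, dotProduct_comm]

lemma Matrix.IsSymm.dotProduct_mulVec_comm {P : Matrix (Fin n) (Fin n) ℝ} (hP : P.IsSymm)
    (x y : Fin n → ℝ) : x ⬝ᵥ (P *ᵥ y) = y ⬝ᵥ (P *ᵥ x) := by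
  conv_lhs => rw [← hP.eq]
  rw [dotProduct_transpose_mulVec, dotProduct_comm]

lemma quad_smul (P : Matrix (Fin n) (Fin n) ℝ) (c : ℝ) (x : Fin n → ℝ) :
    quad P (c • x) = c ^ 2 * quad P x := by
  simp [quad, Matrix.mulVec_smul]; ring

lemma quad_zero (P : Matrix (Fin n) (Fin n) ℝ) : quad P 0 = 0 := by simp [quad]

lemma continuous_quad (P : Matrix (Fin n) (Fin n) ℝ) : Continuous (quad P) := by
  unfold quad; fun_prop

lemma quad_add_of_isSymm {P : Matrix (Fin n) (Fin n) ℝ} (hP : P.IsSymm) (x y : Fin n → ℝ) :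
    quad P (x + y) = quad P x + 2 * (x ⬝ᵥ (P *ᵥ y)) + quad P y := by
  simp only [quad, Matrix.mulVec_add, add_dotProduct, dotProduct_add]
  rw [hP.dotProduct_mulVec_comm y x]; ring

/-- Polarization: it turns convergence of quadratic forms into convergence of entries. -/
lemma Matrix.IsSymm.apply_eq_quad {P : Matrix (Fin n) (Fin n) ℝ} (hP : P.IsSymm) (i j : Fin n) :
    P i j = (quad P (Pi.single i 1 + Pi.single j 1) - quad P (Pi.single i 1)
      - quad P (Pi.single j 1)) / 2 := by
  rw [quad_add_of_isSymm hP]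
  simp only [single_one_dotProduct, Matrix.mulVec_single_one, Matrix.col_apply]
  ring

lemma posDef_of_isSymm_of_quad_pos {P : Matrix (Fin n) (Fin n) ℝ} (hP : P.IsSymm)
    (h : ∀ x, x ≠ 0 → 0 < quad P x) : P.PosDef := by
  refine Matrix.PosDef.of_dotProduct_mulVec_pos ?_ ?_
  · rwa [Matrix.IsHermitian, Matrix.conjTranspose_eq_transpose_of_trivial]
  · intro x hx
    simpa [quad] using h x hx

lemma Matrix.PosDef.quad_pos {P : Matrix (Fin n) (Fin n) ℝ} (hP : P.PosDef) {x : Fin n → ℝ}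
    (hx : x ≠ 0) : 0 < quad P x := by
  simpa [quad] using hP.dotProduct_mulVec_pos hx

lemma Matrix.PosDef.quad_nonneg {P : Matrix (Fin n) (Fin n) ℝ} (hP : P.PosDef) (x : Fin n → ℝ) :
    0 ≤ quad P x := by
  simpa [quad] using hP.posSemidef.dotProduct_mulVec_nonneg x

/-- By homogeneity it suffices to bound the ratio on the unit sphere, which is compact. -/
lemma Matrix.PosDef.exists_quad_le {P : Matrix (Fin n) (Fin n) ℝ} (hP : P.PosDef)
    (L : Matrix (Fin n) (Fin n) ℝ) : ∃ C : ℝ, 0 < C ∧ ∀ x, quad L x ≤ C * quad P x := by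
  have hcont : ContinuousOn (fun x => quad L x / quad P x) (Metric.sphere (0 : Fin n → ℝ) 1) :=
    (continuous_quad L).continuousOn.div (continuous_quad P).continuousOn fun x hx =>
      (hP.quad_pos (by rintro rfl; simp at hx)).ne'
  obtain ⟨C, hC⟩ := (isCompact_sphere (0 : Fin n → ℝ) 1).bddAbove_image hcont
  refine ⟨max C 1, by positivity, fun x => ?_⟩
  by_cases hx : x = 0
  · simp [hx, quad_zero]
  have hx0 : ‖x‖ ≠ 0 := norm_ne_zero_iff.mpr hx
  set y : Fin n → ℝ := ‖x‖⁻¹ • x with hy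
  have hy1 : y ∈ Metric.sphere (0 : Fin n → ℝ) 1 := by
    simp [hy, norm_smul, hx0]
  have hyP : 0 < quad P y := hP.quad_pos (by rintro h; rw [h] at hy1; simp at hy1)
  have h1 : quad L y ≤ max C 1 * quad P y :=
    (div_le_iff₀ hyP).mp ((hC ⟨y, hy1, rfl⟩).trans (le_max_left _ _))
  have hxy : x = ‖x‖ • y := by simp [hy, smul_smul, hx0]
  calc quad L x = ‖x‖ ^ 2 * quad L y := by rw [← quad_smul, ← hxy]
    _ ≤ ‖x‖ ^ 2 * (max C 1 * quad P y) := by gcongr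
    _ = max C 1 * (‖x‖ ^ 2 * quad P y) := by ring
    _ = max C 1 * quad P x := by rw [← quad_smul, ← hxy]

lemma tendsto_zero_of_summable_dotProduct_self {x : ℕ → Fin n → ℝ}
    (h : Summable fun k => x k ⬝ᵥ x k) : Tendsto x atTop (𝓝 0) := by
  rw [tendsto_pi_nhds]
  intro i
  have h0 := h.tendsto_atTop_zero
  have h1 : Tendsto (fun k => (x k i) ^ 2) atTop (𝓝 0) := by
    refine squeeze_zero (fun k => sq_nonneg _) (fun k => ?_) h0
    rw [dotProduct, sq]
    exact Finset.single_le_sum (f := fun i => x k i * x k i)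
      (fun j _ => mul_self_nonneg _) (Finset.mem_univ i)
  have h2 := h1.sqrt
  simp only [Real.sqrt_sq_eq_abs, Real.sqrt_zero] at h2
  exact (tendsto_zero_iff_abs_tendsto_zero _).mpr h2

end quad

/-! ### Schur stability and decay of matrix powers -/

section schur

variable {n : ℕ}

attribute [local instance] Matrix.linftyOpNormedRing Matrix.linftyOpNormedAlgebra

/-- The powers act on the real and imaginary parts of a complex eigenvector separately, so `μ ^ k`
times a nonzero coordinate tends to zero. -/
lemma isSchurStable_of_tendsto {M : Matrix (Fin n) (Fin n) ℝ}
    (h : ∀ x : Fin n → ℝ, Tendsto (fun k => (M ^ k) *ᵥ x) atTop (𝓝 0)) : IsSchurStable M := by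
  intro μ hμ
  obtain ⟨v, hv⟩ := hμ.exists_hasEigenvector
  have hpow : ∀ k : ℕ, (M ^ k).map (algebraMap ℝ ℂ) *ᵥ v = μ ^ k • v := by
    intro k
    have := hv.pow_apply k
    rw [← Matrix.toLin'_pow, Matrix.toLin'_apply] at this
    rw [← this, Matrix.map_pow]
  obtain ⟨i, hi⟩ := Function.ne_iff.mp hv.2
  have hre : ∀ k : ℕ, μ ^ k * v i = ((((M ^ k) *ᵥ fun j => (v j).re) i : ℝ) : ℂ)
      + (((M ^ k) *ᵥ fun j => (v j).im) i : ℝ) * Complex.I := by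
    intro k
    have := congrFun (hpow k) i
    simp only [Pi.smul_apply, smul_eq_mul] at this
    rw [← this]
    simp only [Matrix.mulVec, dotProduct, Matrix.map_apply]
    push_cast
    rw [Finset.sum_mul, ← Finset.sum_add_distrib]
    refine Finset.sum_congr rfl fun j _ => ?_
    conv_lhs => rw [← Complex.re_add_im (v j)]
    simp only [Complex.coe_algebraMap]
    ring
  have hlim : Tendsto (fun k : ℕ => μ ^ k * v i) atTop (𝓝 0) := by
    simp only [hre]
    have h1 := tendsto_pi_nhds.mp (h fun j => (v j).re) i
    have h2 := tendsto_pi_nhds.mp (h fun j => (v j).im) i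
    have h3 := (Complex.continuous_ofReal.tendsto _).comp h1
    have h4 := ((Complex.continuous_ofReal.tendsto _).comp h2).mul_const Complex.I
    simpa using h3.add h4
  have hμk : Tendsto (fun k : ℕ => μ ^ k) atTop (𝓝 0) := by
    have := hlim.mul_const (v i)⁻¹
    simpa [mul_assoc, mul_inv_cancel₀ (show v i ≠ 0 from hi)] using this
  exact tendsto_pow_atTop_nhds_zero_iff_norm_lt_one.mp hμk

/-- Gelfand's formula for the complexification, with `r` strictly between the spectral radius and 1;
the row-sum norm does not change under complexification. -/
lemma IsSchurStable.exists_norm_pow_mulVec_le {M : Matrix (Fin n) (Fin n) ℝ}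
    (h : IsSchurStable M) : ∃ r : ℝ, 0 ≤ r ∧ r < 1 ∧
      ∀ᶠ k : ℕ in atTop, ∀ x : Fin n → ℝ, ‖(M ^ k) *ᵥ x‖ ≤ r ^ k * ‖x‖ := by
  rcases n.eq_zero_or_pos with rfl | hn
  · refine ⟨0, le_rfl, one_pos, Eventually.of_forall fun k x => ?_⟩
    rw [Subsingleton.elim ((M ^ k) *ᵥ x) 0, norm_zero]; positivity
  have : Nonempty (Fin n) := ⟨⟨0, hn⟩⟩
  set N : Matrix (Fin n) (Fin n) ℂ := M.map (algebraMap ℝ ℂ) with hN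
  have hrad : spectralRadius ℂ N < (1 : NNReal) := by
    refine spectrum.spectralRadius_lt_of_forall_lt N fun μ hμ => ?_
    have : Module.End.HasEigenvalue (Matrix.toLin' N) μ := by
      rw [Module.End.hasEigenvalue_iff_mem_spectrum, Matrix.spectrum_toLin']
      exact hμ
    exact_mod_cast h μ this
  obtain ⟨r, hr1, hr2⟩ := ENNReal.lt_iff_exists_nnreal_btwn.mp hrad
  refine ⟨r, r.2, by exact_mod_cast hr2, ?_⟩
  have hG := spectrum.pow_nnnorm_pow_one_div_tendsto_nhds_spectralRadius N
  filter_upwards [hG.eventually (gt_mem_nhds hr1), eventually_gt_atTop 0] with k hk hk0 x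
  have hk' : (‖N ^ k‖₊ : ENNReal) ≤ (r : ENNReal) ^ k := by
    have h1 := ENNReal.rpow_le_rpow hk.le (Nat.cast_nonneg (α := ℝ) k)
    rw [← ENNReal.rpow_mul, one_div, inv_mul_cancel₀ (by positivity), ENNReal.rpow_one,
      ENNReal.rpow_natCast] at h1
    exact h1
  have hk2 : ‖N ^ k‖ ≤ (r : ℝ) ^ k := by exact_mod_cast hk'
  have hnorm : ‖M ^ k‖ = ‖N ^ k‖ := by
    have : N ^ k = (M ^ k).map (algebraMap ℝ ℂ) := by rw [hN, Matrix.map_pow]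
    rw [this, Matrix.linfty_opNorm_def, Matrix.linfty_opNorm_def]
    simp
  calc ‖(M ^ k) *ᵥ x‖ ≤ ‖M ^ k‖ * ‖x‖ := Matrix.linfty_opNorm_mulVec _ _
    _ ≤ (r : ℝ) ^ k * ‖x‖ := by rw [hnorm]; gcongr

end schur

lemma IsSchurStable.tendsto_pow_mulVec {n : ℕ} {M : Matrix (Fin n) (Fin n) ℝ}
    (h : IsSchurStable M) (x : Fin n → ℝ) : Tendsto (fun k => (M ^ k) *ᵥ x) atTop (𝓝 0) := by
  obtain ⟨r, hr0, hr1, hr⟩ := h.exists_norm_pow_mulVec_le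
  refine squeeze_zero_norm' (hr.mono fun k hk => hk x) ?_
  simpa using (tendsto_pow_atTop_nhds_zero_of_lt_one hr0 hr1).mul_const ‖x‖

lemma IsSchurStable.summable_quad {n : ℕ} {M : Matrix (Fin n) (Fin n) ℝ}
    (h : IsSchurStable M) (P : Matrix (Fin n) (Fin n) ℝ) (x : Fin n → ℝ) :
    Summable fun k => quad P ((M ^ k) *ᵥ x) := by
  obtain ⟨r, hr0, hr1, hr⟩ := h.exists_norm_pow_mulVec_le
  have hb : ∃ C : ℝ, ∀ y, |quad P y| ≤ C * ‖y‖ ^ 2 := by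
    refine ⟨∑ i, ∑ j, |P i j|, fun y => ?_⟩
    simp only [quad, dotProduct, Matrix.mulVec, Finset.mul_sum, Finset.sum_mul]
    refine (Finset.abs_sum_le_sum_abs _ _).trans (Finset.sum_le_sum fun i _ => ?_)
    refine (Finset.abs_sum_le_sum_abs _ _).trans (Finset.sum_le_sum fun j _ => ?_)
    have hi : |y i| ≤ ‖y‖ := norm_le_pi_norm y i
    have hj : |y j| ≤ ‖y‖ := norm_le_pi_norm y j
    calc |y i * (P i j * y j)| = |P i j| * (|y i| * |y j|) := by
          rw [abs_mul, abs_mul]; ring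
      _ ≤ |P i j| * (‖y‖ * ‖y‖) := by gcongr
      _ = |P i j| * ‖y‖ ^ 2 := by ring
  obtain ⟨C, hC⟩ := hb
  have hs : Summable fun k : ℕ => |C| * ‖x‖ ^ 2 * (r ^ 2) ^ k :=
    (summable_geometric_of_lt_one (sq_nonneg r) (by nlinarith)).mul_left _
  refine hs.of_norm_bounded_eventually_nat ?_
  filter_upwards [hr] with k hk
  calc ‖quad P ((M ^ k) *ᵥ x)‖ ≤ C * ‖(M ^ k) *ᵥ x‖ ^ 2 := hC _
    _ ≤ |C| * ‖(M ^ k) *ᵥ x‖ ^ 2 := by gcongr; exact le_abs_self C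
    _ ≤ |C| * (r ^ k * ‖x‖) ^ 2 := by gcongr; exact hk x
    _ = _ := by rw [mul_pow, ← pow_mul, ← pow_mul, mul_comm k 2]; ring

/-! ### Completion of squares and the Riccati map -/

namespace LQProblem

variable {n m : ℕ} (p : LQProblem n m)

/-- The Riccati map `P ↦ Q + Aᵀ P A - (Sᵀ + Aᵀ P B) K`, where `K` is the gain of `P`. -/
noncomputable def riccati (P : Matrix (Fin n) (Fin n) ℝ) : Matrix (Fin n) (Fin n) ℝ :=
  p.Q + p.Aᵀ * P * p.A - (p.Sᵀ + p.Aᵀ * P * p.B) * p.gain P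

lemma isSymm_Q (hH : p.H.PosSemidef) : p.Q.IsSymm := by
  have := hH.isHermitian
  rw [LQProblem.H, Matrix.isHermitian_fromBlocks_iff] at this
  simpa [Matrix.IsHermitian, Matrix.IsSymm, Matrix.conjTranspose_eq_transpose_of_trivial] using this.1

lemma isSymm_R (hH : p.H.PosSemidef) : p.R.IsSymm := by
  have := hH.isHermitian
  rw [LQProblem.H, Matrix.isHermitian_fromBlocks_iff] at this
  simpa [Matrix.IsHermitian, Matrix.IsSymm, Matrix.conjTranspose_eq_transpose_of_trivial] using this.2.2.2

lemma stageCost_nonneg (hH : p.H.PosSemidef) (x : Fin n → ℝ) (u : Fin m → ℝ) :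
    0 ≤ p.stageCost x u := by
  simpa [stageCost] using hH.dotProduct_mulVec_nonneg (Sum.elim x u)

lemma stageCost_eq (x : Fin n → ℝ) (u : Fin m → ℝ) :
    p.stageCost x u = quad p.Q x + 2 * (u ⬝ᵥ (p.S *ᵥ x)) + quad p.R u := by
  rw [stageCost, H, Matrix.fromBlocks_mulVec, sumElim_dotProduct_sumElim]
  simp only [Sum.elim_comp_inl, Sum.elim_comp_inr, dotProduct_add,
    dotProduct_transpose_mulVec, quad, dotProduct_comm (p.S *ᵥ x)]
  ring

lemma rotatedH_quad (L : Matrix (Fin n) (Fin n) ℝ) (x : Fin n → ℝ) (u : Fin m → ℝ) :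
    Sum.elim x u ⬝ᵥ (p.rotatedH L *ᵥ Sum.elim x u)
      = p.stageCost x u + quad L x - quad L (p.A *ᵥ x + p.B *ᵥ u) := by
  rw [stageCost_eq, rotatedH, Matrix.fromBlocks_mulVec, sumElim_dotProduct_sumElim]
  simp only [Sum.elim_comp_inl, Sum.elim_comp_inr, dotProduct_add, Matrix.add_mulVec,
    Matrix.sub_mulVec, dotProduct_sub, Matrix.mul_assoc,
    dotProduct_transpose_mulVec, quad, Matrix.mulVec_add, add_dotProduct,
    ← Matrix.mulVec_mulVec, dotProduct_comm (p.S *ᵥ x)]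
  ring

lemma gain_spec {P : Matrix (Fin n) (Fin n) ℝ} (hu : IsUnit (p.R + p.Bᵀ * P * p.B)) :
    (p.R + p.Bᵀ * P * p.B) * p.gain P = p.S + p.Bᵀ * P * p.A := by
  rw [gain, Matrix.mul_nonsing_inv_cancel_left _ _ ((Matrix.isUnit_iff_isUnit_det _).mp hu)]

lemma isSymm_inputWeight (hR : p.R.IsSymm) {P : Matrix (Fin n) (Fin n) ℝ} (hP : P.IsSymm) :
    (p.R + p.Bᵀ * P * p.B).IsSymm := by
  rw [Matrix.IsSymm, Matrix.transpose_add, hR.eq, Matrix.transpose_mul, Matrix.transpose_mul,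
    hP.eq, Matrix.transpose_transpose, Matrix.mul_assoc]

lemma quad_inputWeight (P : Matrix (Fin n) (Fin n) ℝ) (u : Fin m → ℝ) :
    quad (p.R + p.Bᵀ * P * p.B) u = quad p.R u + quad P (p.B *ᵥ u) := by
  simp only [quad, Matrix.add_mulVec, dotProduct_add, Matrix.mul_assoc,
    dotProduct_transpose_mulVec, ← Matrix.mulVec_mulVec]

/-- Completing the square in `u`: the one-step Bellman identity behind both existence and
optimality. -/
lemma stageCost_add_quad (hR : p.R.IsSymm) {P : Matrix (Fin n) (Fin n) ℝ} (hP : P.IsSymm)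
    (hu : IsUnit (p.R + p.Bᵀ * P * p.B)) (x : Fin n → ℝ) (u : Fin m → ℝ) :
    p.stageCost x u + quad P (p.A *ᵥ x + p.B *ᵥ u)
      = quad (p.riccati P) x + quad (p.R + p.Bᵀ * P * p.B) (u + p.gain P *ᵥ x) := by
  have hG := p.isSymm_inputWeight hR hP
  have hspec : (p.R + p.Bᵀ * P * p.B) *ᵥ (p.gain P *ᵥ x)
      = p.S *ᵥ x + p.Bᵀ *ᵥ (P *ᵥ (p.A *ᵥ x)) := by
    rw [Matrix.mulVec_mulVec, p.gain_spec hu, Matrix.add_mulVec]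
    simp only [← Matrix.mulVec_mulVec]
  rw [quad_add_of_isSymm hG, quad_add_of_isSymm hP, stageCost_eq, quad_inputWeight]
  have h1 : quad (p.riccati P) x = quad p.Q x + quad P (p.A *ᵥ x)
      - (p.gain P *ᵥ x) ⬝ᵥ (p.S *ᵥ x + p.Bᵀ *ᵥ (P *ᵥ (p.A *ᵥ x))) := by
    simp only [quad, riccati, Matrix.add_mulVec, Matrix.sub_mulVec, dotProduct_add,
      dotProduct_sub, Matrix.mul_assoc, Matrix.add_mul, ← Matrix.mulVec_mulVec,
      dotProduct_transpose_mulVec]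
    rw [hP.dotProduct_mulVec_comm (p.A *ᵥ x) (p.B *ᵥ _), dotProduct_comm (p.S *ᵥ x)]
  rw [h1, hspec]
  simp only [quad, hspec, dotProduct_add, dotProduct_transpose_mulVec]
  rw [hP.dotProduct_mulVec_comm (p.A *ᵥ x) (p.B *ᵥ _)]
  ring

lemma isSymm_riccati (hQ : p.Q.IsSymm) (hR : p.R.IsSymm) {P : Matrix (Fin n) (Fin n) ℝ}
    (hP : P.IsSymm) : (p.riccati P).IsSymm := by
  have hG := p.isSymm_inputWeight hR hP
  have hF : p.Sᵀ + p.Aᵀ * P * p.B = (p.S + p.Bᵀ * P * p.A)ᵀ := by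
    simp [Matrix.transpose_mul, hP.eq, Matrix.mul_assoc]
  rw [riccati, gain, hF]
  simp [Matrix.IsSymm, Matrix.transpose_mul, hP.eq, hQ.eq, Matrix.mul_assoc,
    Matrix.transpose_nonsing_inv, hR.eq]

end LQProblem

/-! ### Existence of a stabilizing solution by Riccati iteration -/

namespace LQProblem

variable {n m : ℕ} (p : LQProblem n m)

lemma quad_riccati_le (hR : p.R.IsSymm) {P : Matrix (Fin n) (Fin n) ℝ} (hP : P.IsSymm)
    (hG : (p.R + p.Bᵀ * P * p.B).PosDef) (x : Fin n → ℝ) (u : Fin m → ℝ) :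
    quad (p.riccati P) x ≤ p.stageCost x u + quad P (p.A *ᵥ x + p.B *ᵥ u) := by
  rw [p.stageCost_add_quad hR hP hG.isUnit]
  linarith [hG.quad_nonneg (u + p.gain P *ᵥ x)]

lemma closedLoop_mulVec (K : Matrix (Fin m) (Fin n) ℝ) (x : Fin n → ℝ) :
    p.A *ᵥ x + p.B *ᵥ (-(K *ᵥ x)) = (p.A - p.B * K) *ᵥ x := by
  rw [Matrix.sub_mulVec, Matrix.mulVec_neg, Matrix.mulVec_mulVec, sub_eq_add_neg]

lemma quad_riccati_eq (hR : p.R.IsSymm) {P : Matrix (Fin n) (Fin n) ℝ} (hP : P.IsSymm)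
    (hu : IsUnit (p.R + p.Bᵀ * P * p.B)) (x : Fin n → ℝ) :
    quad (p.riccati P) x = p.stageCost x (-(p.gain P *ᵥ x))
      + quad P ((p.A - p.B * p.gain P) *ᵥ x) := by
  rw [← closedLoop_mulVec, p.stageCost_add_quad hR hP hu, neg_add_cancel, quad_zero, add_zero]

lemma continuousAt_riccati {P : Matrix (Fin n) (Fin n) ℝ}
    (hu : IsUnit (p.R + p.Bᵀ * P * p.B)) : ContinuousAt p.riccati P := by
  have hdet : IsUnit (p.R + p.Bᵀ * P * p.B).det := (Matrix.isUnit_iff_isUnit_det _).mp hu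
  have hinv : ContinuousAt (fun P => (p.R + p.Bᵀ * P * p.B)⁻¹) P := by
    simp only [Matrix.inv_def, Ring.inverse_eq_inv']
    refine ContinuousAt.smul (M := ℝ) (X := Matrix (Fin m) (Fin m) ℝ)
      (ContinuousAt.inv₀ ?_ hdet.ne_zero) ?_
    · exact Continuous.continuousAt (by fun_prop)
    · exact Continuous.continuousAt (Continuous.matrix_adjugate (by fun_prop))
  unfold riccati gain
  fun_prop

variable {p} {L : Matrix (Fin n) (Fin n) ℝ} {ε : ℝ}

/-- Dissipation at `x = 0` bounds `R - Bᵀ L B` below by `ε`, and `P ≥ -L` as forms. -/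
lemma posDef_inputWeight (hR : p.R.IsSymm) (hε : 0 < ε)
    (hd : ∀ x u, ε * (x ⬝ᵥ x + u ⬝ᵥ u)
      ≤ p.stageCost x u + quad L x - quad L (p.A *ᵥ x + p.B *ᵥ u))
    {P : Matrix (Fin n) (Fin n) ℝ} (hP : P.IsSymm) (hPL : ∀ x, 0 ≤ quad P x + quad L x) :
    (p.R + p.Bᵀ * P * p.B).PosDef := by
  refine posDef_of_isSymm_of_quad_pos (p.isSymm_inputWeight hR hP) fun u hu => ?_
  have h := hd 0 u
  rw [stageCost_eq] at h
  simp only [quad_zero, Matrix.mulVec_zero, dotProduct_zero, zero_add, mul_zero, add_zero] at h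
  have hpos : 0 < u ⬝ᵥ u := by
    have h1 : 0 ≤ u ⬝ᵥ u := Finset.sum_nonneg fun i _ => mul_self_nonneg (u i)
    exact h1.lt_of_ne' fun h2 => hu (dotProduct_self_eq_zero.mp h2)
  rw [quad_inputWeight]
  linarith [hPL (p.B *ᵥ u), mul_pos hε hpos]

/-- Dissipation evaluated along the feedback of `P`. It keeps the iterates above `-L`, and at a
fixed point it is a Lyapunov decrease for `P + L`. -/
lemma dotProduct_self_le_of_riccati (hR : p.R.IsSymm) (hε : 0 < ε)
    (hd : ∀ x u, ε * (x ⬝ᵥ x + u ⬝ᵥ u)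
      ≤ p.stageCost x u + quad L x - quad L (p.A *ᵥ x + p.B *ᵥ u))
    {P : Matrix (Fin n) (Fin n) ℝ} (hP : P.IsSymm)
    (hu : IsUnit (p.R + p.Bᵀ * P * p.B)) (x : Fin n → ℝ) :
    ε * (x ⬝ᵥ x) + (quad P ((p.A - p.B * p.gain P) *ᵥ x)
        + quad L ((p.A - p.B * p.gain P) *ᵥ x))
      ≤ quad (p.riccati P) x + quad L x := by
  have h := hd x (-(p.gain P *ᵥ x))
  rw [closedLoop_mulVec] at h
  rw [p.quad_riccati_eq hR hP hu]
  have h1 : 0 ≤ (-(p.gain P *ᵥ x)) ⬝ᵥ (-(p.gain P *ᵥ x)) :=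
    Finset.sum_nonneg fun i _ => mul_self_nonneg _
  nlinarith [mul_nonneg hε.le h1]

lemma isSchurStable_of_isDARESolution (hR : p.R.IsSymm) (hε : 0 < ε)
    (hd : ∀ x u, ε * (x ⬝ᵥ x + u ⬝ᵥ u)
      ≤ p.stageCost x u + quad L x - quad L (p.A *ᵥ x + p.B *ᵥ u))
    {P : Matrix (Fin n) (Fin n) ℝ} (hP : p.IsDARESolution P)
    (hPL : ∀ x, 0 ≤ quad P x + quad L x) : IsSchurStable (p.A - p.B * p.gain P) := by
  set M := p.A - p.B * p.gain P with hM
  refine isSchurStable_of_tendsto fun x => tendsto_zero_of_summable_dotProduct_self ?_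
  have hdec : ∀ y, ε * (y ⬝ᵥ y) + (quad P (M *ᵥ y) + quad L (M *ᵥ y)) ≤ quad P y + quad L y := by
    intro y
    have := dotProduct_self_le_of_riccati hR hε hd hP.symm hP.isUnit y
    rwa [show p.riccati P = P from hP.eqn.symm] at this
  have hsum : ∀ N, ε * ∑ k ∈ Finset.range N, ((M ^ k) *ᵥ x) ⬝ᵥ ((M ^ k) *ᵥ x)
      + (quad P ((M ^ N) *ᵥ x) + quad L ((M ^ N) *ᵥ x)) ≤ quad P x + quad L x := by
    intro N
    induction N with
    | zero => simp
    | succ N ih =>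
      have h := hdec ((M ^ N) *ᵥ x)
      rw [Matrix.mulVec_mulVec, ← pow_succ'] at h
      rw [Finset.sum_range_succ, mul_add]
      linarith
  refine summable_of_sum_range_le (c := (quad P x + quad L x) / ε)
    (fun k => Finset.sum_nonneg fun i _ => mul_self_nonneg _) fun N => ?_
  rw [le_div_iff₀' hε]
  linarith [hsum N, hPL ((M ^ N) *ᵥ x)]

lemma exists_tendsto_of_quad_monotone {P : ℕ → Matrix (Fin n) (Fin n) ℝ}
    (hP : ∀ k, (P k).IsSymm) (hmono : ∀ x, Monotone fun k => quad (P k) x)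
    (hbdd : ∀ x, BddAbove (Set.range fun k => quad (P k) x)) :
    ∃ X : Matrix (Fin n) (Fin n) ℝ, Tendsto P atTop (𝓝 X) := by
  have hq : ∀ x, Tendsto (fun k => quad (P k) x) atTop (𝓝 (⨆ k, quad (P k) x)) :=
    fun x => tendsto_atTop_ciSup (hmono x) (hbdd x)
  have hlim (i j : Fin n) := (((hq (Pi.single i 1 + Pi.single j 1)).sub
    (hq (Pi.single i 1))).sub (hq (Pi.single j 1))).div_const 2
  simp only [← (hP _).apply_eq_quad] at hlim
  exact ⟨Matrix.of fun i j => _, tendsto_pi_nhds.mpr fun i => tendsto_pi_nhds.mpr fun j => hlim i j⟩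

/-- Under linear feedback the stage cost is a single quadratic form of the state, hence summable
along the geometrically decaying trajectory. -/
lemma bddAbove_feedbackCost {K : Matrix (Fin m) (Fin n) ℝ}
    (hK : IsSchurStable (p.A - p.B * K)) (x : Fin n → ℝ) :
    BddAbove (Set.range fun N : ℕ => ∑ k ∈ Finset.range N,
      p.stageCost (((p.A - p.B * K) ^ k) *ᵥ x) (-(K *ᵥ (((p.A - p.B * K) ^ k) *ᵥ x)))) := by
  have hM : ∀ y, p.stageCost y (-(K *ᵥ y))
      = quad (p.Q - (2 : ℝ) • (Kᵀ * p.S) + Kᵀ * (p.R * K)) y := by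
    intro y
    rw [stageCost_eq]
    simp only [quad, Matrix.add_mulVec, Matrix.sub_mulVec, Matrix.smul_mulVec,
      dotProduct_add, dotProduct_sub, dotProduct_smul, ← Matrix.mulVec_mulVec,
      dotProduct_transpose_mulVec, Matrix.mulVec_neg, dotProduct_neg, neg_dotProduct, smul_eq_mul]
    ring
  have hs := hK.summable_quad (p.Q - (2 : ℝ) • (Kᵀ * p.S) + Kᵀ * (p.R * K)) x
  simp only [← hM] at hs
  exact hs.hasSum.tendsto_sum_nat.bddAbove_range

theorem exists_isStabilizingSolution (hH : p.H.PosSemidef) (hstab : IsStabilizable p.A p.B)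
    (hε : 0 < ε)
    (hd : ∀ x u, ε * (x ⬝ᵥ x + u ⬝ᵥ u)
      ≤ p.stageCost x u + quad L x - quad L (p.A *ᵥ x + p.B *ᵥ u)) :
    ∃ P : Matrix (Fin n) (Fin n) ℝ, p.IsStabilizingSolution P := by
  have hQ := p.isSymm_Q hH
  have hR := p.isSymm_R hH
  -- `L` need not be symmetric, so the iteration starts at minus its symmetric part, which has the
  -- quadratic form `-L`.
  set P₀ : Matrix (Fin n) (Fin n) ℝ := -((1 / 2 : ℝ) • (L + Lᵀ)) with hP₀
  have hP₀symm : P₀.IsSymm := by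
    simp [hP₀, Matrix.IsSymm, add_comm]
  have hP₀quad : ∀ x, quad P₀ x = -quad L x := by
    intro x
    simp only [hP₀, quad, Matrix.neg_mulVec, Matrix.smul_mulVec, Matrix.add_mulVec,
      dotProduct_neg, dotProduct_smul, dotProduct_add, dotProduct_transpose_mulVec,
      dotProduct_comm (L *ᵥ x), smul_eq_mul]
    ring
  set P : ℕ → Matrix (Fin n) (Fin n) ℝ := fun k => p.riccati^[k] P₀ with hPdef
  have hPsucc : ∀ k, P (k + 1) = p.riccati (P k) := fun k => Function.iterate_succ_apply' _ _ _
  have hsymm : ∀ k, (P k).IsSymm := by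
    intro k
    induction k with
    | zero => exact hP₀symm
    | succ k ih => rw [hPsucc]; exact p.isSymm_riccati hQ hR ih
  have hself : ∀ y : Fin n → ℝ, 0 ≤ y ⬝ᵥ y := fun y =>
    Finset.sum_nonneg fun i _ => mul_self_nonneg _
  have hnonneg : ∀ k x, 0 ≤ quad (P k) x + quad L x := by
    intro k
    induction k with
    | zero => intro x; exact (by rw [hP₀quad]; simp : 0 ≤ quad P₀ x + quad L x)
    | succ k ih =>
      intro x
      have hG := posDef_inputWeight hR hε hd (hsymm k) ih
      have := dotProduct_self_le_of_riccati hR hε hd (hsymm k) hG.isUnit x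
      rw [hPsucc]
      linarith [ih ((p.A - p.B * p.gain (P k)) *ᵥ x), mul_nonneg hε.le (hself x)]
  have hG : ∀ k, (p.R + p.Bᵀ * P k * p.B).PosDef := fun k =>
    posDef_inputWeight hR hε hd (hsymm k) (hnonneg k)
  -- The base case is `P 1 ≥ -L = P 0`. Afterwards, the minimizing input for `P (k + 1)` is merely
  -- admissible for `P k`, so the order is inherited.
  have hstep : ∀ k x, quad (P k) x ≤ quad (P (k + 1)) x := by
    intro k
    induction k with
    | zero =>
      intro x
      have h1 := hnonneg 1 x
      have h2 : quad (P 0) x = -quad L x := hP₀quad x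
      rw [zero_add, h2]
      linarith
    | succ k ih =>
      intro x
      have h1 := p.quad_riccati_eq hR (hsymm (k + 1)) (hG (k + 1)).isUnit x
      have h2 := p.quad_riccati_le hR (hsymm k) (hG k) x (-(p.gain (P (k + 1)) *ᵥ x))
      rw [closedLoop_mulVec, ← hPsucc] at h2
      rw [hPsucc (k + 1), h1]
      linarith [ih ((p.A - p.B * p.gain (P (k + 1))) *ᵥ x)]
  obtain ⟨K, hK⟩ := hstab
  have hbdd : ∀ x, BddAbove (Set.range fun k => quad (P k) x) := by
    intro x
    obtain ⟨C, hC⟩ := bddAbove_feedbackCost hK x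
    -- `P N` is the optimal cost over horizon `N` with terminal cost `-L`; the feedback `K` gives an
    -- upper bound for it.
    have hle : ∀ N x, quad (P N) x ≤ (∑ k ∈ Finset.range N,
        p.stageCost (((p.A - p.B * K) ^ k) *ᵥ x) (-(K *ᵥ (((p.A - p.B * K) ^ k) *ᵥ x))))
        - quad L (((p.A - p.B * K) ^ N) *ᵥ x) := by
      intro N
      induction N with
      | zero => intro x; simpa using (show quad (P 0) x = -quad L x from hP₀quad x).le
      | succ N ih =>
        intro x
        have h1 := p.quad_riccati_le hR (hsymm N) (hG N) x (-(K *ᵥ x))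
        have h2 := ih ((p.A - p.B * K) *ᵥ x)
        have hpow : ∀ k : ℕ, (p.A - p.B * K) ^ k *ᵥ ((p.A - p.B * K) *ᵥ x)
            = (p.A - p.B * K) ^ (k + 1) *ᵥ x := fun k => by
          rw [Matrix.mulVec_mulVec, ← pow_succ]
        simp only [hpow] at h2
        rw [closedLoop_mulVec] at h1
        rw [hPsucc, Finset.sum_range_succ']
        simp only [pow_zero, Matrix.one_mulVec]
        linarith
    have hlim : Tendsto (fun N : ℕ => quad L (((p.A - p.B * K) ^ N) *ᵥ x)) atTop (𝓝 0) := by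
      have := ((continuous_quad L).tendsto 0).comp (hK.tendsto_pow_mulVec x)
      rwa [quad_zero] at this
    obtain ⟨b, hb⟩ := hlim.bddBelow_range
    refine ⟨C - b, ?_⟩
    rintro _ ⟨N, rfl⟩
    exact (hle N x).trans (sub_le_sub (hC ⟨N, rfl⟩) (hb ⟨N, rfl⟩))
  obtain ⟨X, hX⟩ := exists_tendsto_of_quad_monotone hsymm
    (fun x => monotone_nat_of_le_succ fun k => hstep k x) hbdd
  have hXsymm : X.IsSymm := by
    have h1 : Tendsto (fun k => (P k)ᵀ) atTop (𝓝 Xᵀ) :=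
      ((continuous_id.matrix_transpose).tendsto X).comp hX
    simp only [(hsymm _).eq] at h1
    exact tendsto_nhds_unique h1 hX
  have hXL : ∀ x, 0 ≤ quad X x + quad L x := by
    intro x
    have hc : Continuous fun Y : Matrix (Fin n) (Fin n) ℝ => quad Y x + quad L x := by
      unfold quad; fun_prop
    exact ge_of_tendsto' ((hc.tendsto X).comp hX) fun k => hnonneg k x
  have hXu := (posDef_inputWeight hR hε hd hXsymm hXL).isUnit
  have hfix : X = p.riccati X := by
    have h1 : Tendsto (fun k => p.riccati (P k)) atTop (𝓝 (p.riccati X)) :=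
      (p.continuousAt_riccati hXu).tendsto.comp hX
    simp only [← hPsucc] at h1
    exact tendsto_nhds_unique ((tendsto_add_atTop_iff_nat 1).mpr hX) h1
  have hsol : p.IsDARESolution X := ⟨hXsymm, hXu, hfix⟩
  exact ⟨X, hsol, isSchurStable_of_isDARESolution hR hε hd hsol hXL⟩

end LQProblem

/-! ### Convergence of the infinite-horizon cost -/

namespace LQProblem

variable {n m : ℕ} {p : LQProblem n m} {L : Matrix (Fin n) (Fin n) ℝ} {ε : ℝ}

lemma finiteCost_eq (x₀ : Fin n → ℝ) (u : ℕ → Fin m → ℝ) (N : ℕ) :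
    p.finiteCost x₀ u N = (∑ k ∈ Finset.range N, p.stageCost (p.state x₀ u k) (u k))
      + quad p.Pf (p.state x₀ u N) := rfl

lemma state_succ (x₀ : Fin n → ℝ) (u : ℕ → Fin m → ℝ) (k : ℕ) :
    p.state x₀ u (k + 1) = p.A *ᵥ p.state x₀ u k + p.B *ᵥ u k := rfl

lemma sum_dotProduct_self_le
    (hd : ∀ x u, ε * (x ⬝ᵥ x + u ⬝ᵥ u)
      ≤ p.stageCost x u + quad L x - quad L (p.A *ᵥ x + p.B *ᵥ u)) (hε : 0 < ε)
    (x₀ : Fin n → ℝ) (u : ℕ → Fin m → ℝ) (N : ℕ) :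
    ε * ∑ k ∈ Finset.range N, p.state x₀ u k ⬝ᵥ p.state x₀ u k
      ≤ (∑ k ∈ Finset.range N, p.stageCost (p.state x₀ u k) (u k))
        + quad L x₀ - quad L (p.state x₀ u N) := by
  induction N with
  | zero => simp [state]
  | succ N ih =>
    have h := hd (p.state x₀ u N) (u N)
    rw [← state_succ] at h
    have h1 : 0 ≤ u N ⬝ᵥ u N := Finset.sum_nonneg fun i _ => mul_self_nonneg _
    rw [Finset.sum_range_succ, Finset.sum_range_succ, mul_add]
    nlinarith [mul_nonneg hε.le h1]

/-- Either the cost of an input sequence diverges to `+∞`, or it converges and the state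
converges to the origin. -/
theorem finiteCost_dichotomy (hH : p.H.PosSemidef) (hPf : p.Pf.PosDef) (hε : 0 < ε)
    (hd : ∀ x u, ε * (x ⬝ᵥ x + u ⬝ᵥ u)
      ≤ p.stageCost x u + quad L x - quad L (p.A *ᵥ x + p.B *ᵥ u))
    (x₀ : Fin n → ℝ) (u : ℕ → Fin m → ℝ) :
    Tendsto (p.finiteCost x₀ u) atTop atTop ∨
      (Tendsto (p.state x₀ u) atTop (𝓝 0) ∧ ∃ c, Tendsto (p.finiteCost x₀ u) atTop (𝓝 c)) := by
  set s : ℕ → ℝ := fun N => ∑ k ∈ Finset.range N, p.stageCost (p.state x₀ u k) (u k) with hs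
  have hmono : Monotone s := monotone_nat_of_le_succ fun N => by
    simp only [hs, Finset.sum_range_succ]
    linarith [p.stageCost_nonneg hH (p.state x₀ u N) (u N)]
  have hs0 : ∀ N, 0 ≤ s N := fun N => Finset.sum_nonneg fun k _ => p.stageCost_nonneg hH _ _
  rcases tendsto_atTop_of_monotone hmono with htop | ⟨c, hc⟩
  · left
    refine tendsto_atTop_mono (fun N => ?_) htop
    rw [finiteCost_eq]
    linarith [hPf.quad_nonneg (p.state x₀ u N)]
  by_cases hbot : Tendsto (fun N => quad L (p.state x₀ u N)) atTop atBot
  · left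
    -- Positive definiteness of `Pf` gives `-L ≤ C Pf`, so the terminal cost alone diverges.
    obtain ⟨C, hC0, hC⟩ := hPf.exists_quad_le (-L)
    have hneg : Tendsto (fun N => C⁻¹ * -quad L (p.state x₀ u N)) atTop atTop :=
      (tendsto_neg_atBot_atTop.comp hbot).const_mul_atTop (inv_pos.mpr hC0)
    refine tendsto_atTop_mono (fun N => ?_) hneg
    have h1 := hC (p.state x₀ u N)
    have h2 : quad (-L) (p.state x₀ u N) = -quad L (p.state x₀ u N) := by
      simp [quad, Matrix.neg_mulVec]
    rw [h2] at h1
    have h3 : C⁻¹ * -quad L (p.state x₀ u N) ≤ quad p.Pf (p.state x₀ u N) := by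
      rwa [inv_mul_le_iff₀ hC0]
    exact h3.trans (by rw [finiteCost_eq]; exact le_add_of_nonneg_left (hs0 N))
  · right
    rw [tendsto_atBot] at hbot
    push Not at hbot
    obtain ⟨b, hb⟩ := hbot
    have hsum : Summable fun k => p.state x₀ u k ⬝ᵥ p.state x₀ u k := by
      have hnn : ∀ k, 0 ≤ p.state x₀ u k ⬝ᵥ p.state x₀ u k := fun k =>
        Finset.sum_nonneg fun i _ => mul_self_nonneg _
      refine summable_of_sum_range_le (c := (c + quad L x₀ - b) / ε) hnn fun N => ?_
      -- `L(x_N) ≥ b` is known only for infinitely many `N`; this suffices because the partial sums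
      -- increase, so any `N` can be pushed up to such an `N'`.
      obtain ⟨N', hN', hbN'⟩ := frequently_atTop.mp hb N
      refine (Finset.sum_le_sum_of_subset_of_nonneg (Finset.range_mono hN')
        fun k _ _ => hnn k).trans ?_
      rw [le_div_iff₀' hε]
      have h1 := sum_dotProduct_self_le hd hε x₀ u N'
      have h2 : s N' ≤ c := hmono.ge_of_tendsto hc N'
      simp only [hs] at h2
      linarith
    have hx := tendsto_zero_of_summable_dotProduct_self hsum
    refine ⟨hx, c, ?_⟩
    have hq := ((continuous_quad p.Pf).tendsto 0).comp hx
    rw [quad_zero] at hq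
    have h := hc.add hq
    rwa [add_zero] at h

lemma exists_hasInfiniteCost (hH : p.H.PosSemidef) (hPf : p.Pf.PosDef) (hε : 0 < ε)
    (hd : ∀ x u, ε * (x ⬝ᵥ x + u ⬝ᵥ u)
      ≤ p.stageCost x u + quad L x - quad L (p.A *ᵥ x + p.B *ᵥ u))
    (x₀ : Fin n → ℝ) (u : ℕ → Fin m → ℝ) : ∃ J : EReal, p.HasInfiniteCost x₀ u J := by
  rcases finiteCost_dichotomy hH hPf hε hd x₀ u with h | ⟨-, c, hc⟩
  · exact ⟨⊤, EReal.tendsto_coe_nhds_top_iff.mpr h⟩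
  · exact ⟨c, EReal.tendsto_coe.mpr hc⟩

/-! ### Optimality of a stabilizing solution -/

section stabilizing

variable {P : Matrix (Fin n) (Fin n) ℝ}

lemma IsDARESolution.sum_stageCost_add_quad (hP : p.IsDARESolution P) (hR : p.R.IsSymm)
    (x₀ : Fin n → ℝ) (u : ℕ → Fin m → ℝ) (N : ℕ) :
    (∑ k ∈ Finset.range N, p.stageCost (p.state x₀ u k) (u k)) + quad P (p.state x₀ u N)
      = quad P x₀ + ∑ k ∈ Finset.range N,
        quad (p.R + p.Bᵀ * P * p.B) (u k + p.gain P *ᵥ p.state x₀ u k) := by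
  induction N with
  | zero => simp [state]
  | succ N ih =>
    have h := p.stageCost_add_quad hR hP.symm hP.isUnit (p.state x₀ u N) (u N)
    rw [← state_succ, show p.riccati P = P from hP.eqn.symm] at h
    rw [Finset.sum_range_succ, Finset.sum_range_succ]
    linarith

lemma exists_feedback_input (K : Matrix (Fin m) (Fin n) ℝ) (x₀ : Fin n → ℝ) :
    ∃ u : ℕ → Fin m → ℝ, ∀ k, u k = -(K *ᵥ p.state x₀ u k) := by
  -- The closed form in powers of `A - B K` avoids the circular dependence of input and state.
  refine ⟨fun k => -(K *ᵥ (((p.A - p.B * K) ^ k) *ᵥ x₀)), fun k => ?_⟩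
  suffices h : p.state x₀ (fun k => -(K *ᵥ (((p.A - p.B * K) ^ k) *ᵥ x₀))) k
      = ((p.A - p.B * K) ^ k) *ᵥ x₀ by rw [h]
  induction k with
  | zero => simp [state]
  | succ k ih => rw [state_succ, ih, closedLoop_mulVec, Matrix.mulVec_mulVec, ← pow_succ']

lemma state_eq_of_feedback {K : Matrix (Fin m) (Fin n) ℝ} {x₀ : Fin n → ℝ}
    {u : ℕ → Fin m → ℝ} (hu : ∀ k, u k = -(K *ᵥ p.state x₀ u k)) (k : ℕ) :
    p.state x₀ u k = ((p.A - p.B * K) ^ k) *ᵥ x₀ := by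
  induction k with
  | zero => simp [state]
  | succ k ih =>
    rw [state_succ, hu k, closedLoop_mulVec, ih, Matrix.mulVec_mulVec, ← pow_succ']

lemma IsStabilizingSolution.tendsto_finiteCost (hP : p.IsStabilizingSolution P)
    (hR : p.R.IsSymm) {x₀ : Fin n → ℝ} {u : ℕ → Fin m → ℝ}
    (hu : ∀ k, u k = -(p.gain P *ᵥ p.state x₀ u k)) :
    Tendsto (p.finiteCost x₀ u) atTop (𝓝 (quad P x₀)) := by
  have hx : Tendsto (p.state x₀ u) atTop (𝓝 0) := by
    simpa only [← state_eq_of_feedback hu] using hP.schur.tendsto_pow_mulVec x₀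
  have hq (M : Matrix (Fin n) (Fin n) ℝ) :
      Tendsto (fun N => quad M (p.state x₀ u N)) atTop (𝓝 0) := by
    have := ((continuous_quad M).tendsto 0).comp hx
    rwa [quad_zero] at this
  have h1 : p.finiteCost x₀ u
      = fun N => quad P x₀ - quad P (p.state x₀ u N) + quad p.Pf (p.state x₀ u N) := by
    funext N
    have h := hP.isSolution.sum_stageCost_add_quad hR x₀ u N
    have h0 : ∀ k, u k + p.gain P *ᵥ p.state x₀ u k = 0 := fun k => by
      rw [hu k, neg_add_cancel]
    simp only [h0, quad_zero, Finset.sum_const_zero] at h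
    rw [finiteCost_eq]
    linarith
  rw [h1]
  simpa using ((hq P).const_sub (quad P x₀)).add (hq p.Pf)

/-- `P(x₀)` is the limit of the nonnegative costs produced by its own feedback. -/
lemma IsStabilizingSolution.quad_nonneg (hP : p.IsStabilizingSolution P) (hH : p.H.PosSemidef)
    (hPf : p.Pf.PosDef) (x₀ : Fin n → ℝ) : 0 ≤ quad P x₀ := by
  obtain ⟨u, hu⟩ := p.exists_feedback_input (p.gain P) x₀
  refine ge_of_tendsto' (hP.tendsto_finiteCost (p.isSymm_R hH) hu) fun N => ?_
  exact add_nonneg (Finset.sum_nonneg fun k _ => p.stageCost_nonneg hH _ _) (hPf.quad_nonneg _)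

/-- For an arbitrary stabilizing `P` the bound `P + L ≥ 0` is not at hand. Instead `R ≥ 0` and `P ≥
0` give semidefiniteness, and the DARE supplies invertibility. -/
lemma IsStabilizingSolution.posDef_inputWeight (hP : p.IsStabilizingSolution P)
    (hH : p.H.PosSemidef) (hPf : p.Pf.PosDef) : (p.R + p.Bᵀ * P * p.B).PosDef := by
  have hsymm := p.isSymm_inputWeight (p.isSymm_R hH) hP.isSolution.symm
  have hpsd : (p.R + p.Bᵀ * P * p.B).PosSemidef := by
    refine Matrix.PosSemidef.of_dotProduct_mulVec_nonneg ?_ fun u => ?_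
    · rwa [Matrix.IsHermitian, Matrix.conjTranspose_eq_transpose_of_trivial]
    · have h1 := p.stageCost_nonneg hH 0 u
      rw [stageCost_eq] at h1
      simp only [quad_zero, Matrix.mulVec_zero, dotProduct_zero, zero_add, mul_zero] at h1
      have h2 := p.quad_inputWeight P u
      have h3 := hP.quad_nonneg hH hPf (p.B *ᵥ u)
      rw [star_trivial]
      change 0 ≤ quad _ u
      linarith
  exact hpsd.posDef_iff_isUnit.mpr hP.isSolution.isUnit

/-- Every cost of an input sequence `u` exceeds `xᵀ P x` by at least the weighted square of each
deviation of `u` from the feedback `-K x`. -/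
lemma IsStabilizingSolution.le_of_hasInfiniteCost (hP : p.IsStabilizingSolution P)
    (hH : p.H.PosSemidef) (hPf : p.Pf.PosDef) (hε : 0 < ε)
    (hd : ∀ x u, ε * (x ⬝ᵥ x + u ⬝ᵥ u)
      ≤ p.stageCost x u + quad L x - quad L (p.A *ᵥ x + p.B *ᵥ u))
    {x₀ : Fin n → ℝ} {u : ℕ → Fin m → ℝ} {J : EReal} (hJ : p.HasInfiniteCost x₀ u J) (j : ℕ) :
    ((quad P x₀ + quad (p.R + p.Bᵀ * P * p.B) (u j + p.gain P *ᵥ p.state x₀ u j) : ℝ) : EReal)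
      ≤ J := by
  have hG := hP.posDef_inputWeight hH hPf
  rcases finiteCost_dichotomy hH hPf hε hd x₀ u with h | ⟨hx, c, hc⟩
  · rw [tendsto_nhds_unique hJ (EReal.tendsto_coe_nhds_top_iff.mpr h)]
    exact le_top
  rw [tendsto_nhds_unique hJ (EReal.tendsto_coe.mpr hc), EReal.coe_le_coe_iff]
  have hq (M : Matrix (Fin n) (Fin n) ℝ) :
      Tendsto (fun N => quad M (p.state x₀ u N)) atTop (𝓝 0) := by
    have := ((continuous_quad M).tendsto 0).comp hx
    rwa [quad_zero] at this
  -- Since the state vanishes in the limit, the terminal weight `Pf` may be exchanged for `P`.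
  have hlim : Tendsto (fun N => p.finiteCost x₀ u N - quad p.Pf (p.state x₀ u N)
      + quad P (p.state x₀ u N)) atTop (𝓝 c) := by
    simpa using (hc.sub (hq p.Pf)).add (hq P)
  refine ge_of_tendsto hlim ?_
  filter_upwards [eventually_gt_atTop j] with N hN
  have h := hP.isSolution.sum_stageCost_add_quad (p.isSymm_R hH) x₀ u N
  have h1 := Finset.single_le_sum
    (f := fun k => quad (p.R + p.Bᵀ * P * p.B) (u k + p.gain P *ᵥ p.state x₀ u k))
    (fun k _ => hG.quad_nonneg _) (Finset.mem_range.mpr hN)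
  rw [finiteCost_eq]
  linarith

theorem IsStabilizingSolution.isValueFunction (hP : p.IsStabilizingSolution P)
    (hH : p.H.PosSemidef) (hPf : p.Pf.PosDef) (hε : 0 < ε)
    (hd : ∀ x u, ε * (x ⬝ᵥ x + u ⬝ᵥ u)
      ≤ p.stageCost x u + quad L x - quad L (p.A *ᵥ x + p.B *ᵥ u)) :
    p.IsValueFunction (quad P) := by
  intro x₀
  constructor
  · obtain ⟨u, hu⟩ := p.exists_feedback_input (p.gain P) x₀
    exact ⟨u, EReal.tendsto_coe.mpr (hP.tendsto_finiteCost (p.isSymm_R hH) hu)⟩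
  · rintro J ⟨u, hJ⟩
    refine le_trans ?_ (hP.le_of_hasInfiniteCost hH hPf hε hd hJ 0)
    rw [EReal.coe_le_coe_iff]
    linarith [(hP.posDef_inputWeight hH hPf).quad_nonneg (u 0 + p.gain P *ᵥ p.state x₀ u 0)]

theorem IsStabilizingSolution.isOptimalFeedback (hP : p.IsStabilizingSolution P)
    (hH : p.H.PosSemidef) (hPf : p.Pf.PosDef) (hε : 0 < ε)
    (hd : ∀ x u, ε * (x ⬝ᵥ x + u ⬝ᵥ u)
      ≤ p.stageCost x u + quad L x - quad L (p.A *ᵥ x + p.B *ᵥ u)) :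
    p.IsOptimalFeedback (fun x => -(p.gain P *ᵥ x)) := by
  intro x₀ u
  have hV := hP.isValueFunction hH hPf hε hd x₀
  constructor
  · rintro ⟨J, hJ, hmin⟩ k
    -- With optimal cost equal to `P(x₀)` there is no room for a positive square at any single time
    -- `k`.
    have h := hP.le_of_hasInfiniteCost hH hPf hε hd hJ k
    rw [hmin.unique hV, EReal.coe_le_coe_iff] at h
    by_contra hne
    have hpos := (hP.posDef_inputWeight hH hPf).quad_pos
      (x := u k + p.gain P *ᵥ p.state x₀ u k) fun h0 => hne (eq_neg_of_add_eq_zero_left h0)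
    linarith
  · intro hu
    exact ⟨_, EReal.tendsto_coe.mpr (hP.tendsto_finiteCost (p.isSymm_R hH) hu), hV⟩

end stabilizing

end LQProblem

theorem mainTheorem4 (n m : ℕ) (p : LQProblem n m)
    (hH : p.H.PosSemidef) (hPf : p.Pf.PosDef)
    (hstab : IsStabilizable p.A p.B) (hdiss : p.QuadStrictPreDissipative) :
    (∃ P : Matrix (Fin n) (Fin n) ℝ, p.IsStabilizingSolution P) ∧
    (∀ (x₀ : Fin n → ℝ) (u : ℕ → Fin m → ℝ), ∃ J : EReal, p.HasInfiniteCost x₀ u J) ∧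
    ∀ P : Matrix (Fin n) (Fin n) ℝ, p.IsStabilizingSolution P →
      p.IsValueFunction (fun x => x ⬝ᵥ (P *ᵥ x)) ∧
      p.IsOptimalFeedback (fun x => -(p.gain P *ᵥ x)) := by
  obtain ⟨L, ε, hε, hd⟩ := hdiss
  simp only [LQProblem.rotatedH_quad] at hd
  exact ⟨LQProblem.exists_isStabilizingSolution hH hstab hε hd,
    LQProblem.exists_hasInfiniteCost hH hPf hε hd,
    fun P hP => ⟨hP.isValueFunction hH hPf hε hd, hP.isOptimalFeedback hH hPf hε hd⟩⟩
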